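/- For $n\ge 1$ let $\mathrm{MAJORITY\text{-}OR\text{-}NONE}_n$ be the partial Boolean function defined on those $x\in\{0,1\}^n$ whose Hamming weight $|x|$ is $0$ or at least $n/2$, with value $0$ if $|x|=0$ and value $1$ otherwise. For a partial Boolean function $f$ on a domain $D\subseteq\{0,1\}^n$, define the following measures. * $\mathrm{RP}(f)$: the least $T$ such that some randomized decision tree (a probability distribution on deterministic decision trees of depth at most $T$) outputs $0$ with probability $1$ whenever $f(x)=0$ and outputs $1$ with probability at least $2/3$ whenever $f(x)=1$, for $x \in D$. * $\mathrm{Q}(f)$: the least number of queries to the oracle $|i\rangle|c\rangle\mapsto|i\rangle|c\oplus x_i\rangle$ made by a quantum algorithm which, for every $x\in D$, outputs $f(x)$ with probability at least $2/3$. * $\mathrm{PostQ}_E(f)$: the least number of queries to the same oracle made by a quantum algorithm which, by measuring its final state, produces two bits $a,b$ such that for every $x\in D$ one has $\Pr[b=1]>0$ and $\Pr[a=1\mid b=1]$ equals $1$ if $f(x)=1$ and $0$ if $f(x)=0$ (zero-error post-selected quantum query complexity). * Identify bits with signs by $0\mapsto 1$, $1\mapsto -1$, so that $D\subseteq\{-1,1\}^n$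 and $f\colon D\to\{-1,1\}$. The approximate degree $\widetilde{\deg}(f)$ is the least degree of a real polynomial $p$ with $|p(x)-f(x)|\le 1/3$ for all $x\in D$ and $|p(x)|\le 1$ for all $x\in\{-1,1\}^n$. The rational degree $\mathrm{rdeg}(f)$ is the least value of $\max\{\deg p,\deg q\}$ over real polynomials $p,q$ with $q(x)\neq 0$ and $f(x)=p(x)/q(x)$ for all $x\in D$. **Theorem.** There are an absolute constant $C$ and an absolute constant $K$ such that for all $n\ge 1$, writing $f=\mathrm{MAJORITY\text{-}OR\text{-}NONE}_n$, $$\mathrm{RP}(f)\le C,\qquad \mathrm{Q}(f)\le C,\qquad \widetilde{\deg}(f)\le C,$$ while $$n \le K\cdot \mathrm{rdeg}(f)\qquad\text{and}\qquad n\le K\cdot \mathrm{PostQ}_E(f).$$ That is, $f$ has constant one-sided-error randomized and constant quantum query complexity and constant approximate degree, but its rational degree and its zero-error post-selected quantum query complexity are $\Omega(n)$. -/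

import Mathlib

open scoped Matrix

noncomputable section

namespace BoolQuery

/-! ### Partial Boolean functions -/

/-- A partial Boolean function on `n`-bit strings: a function on a set `dom ⊆ {0,1}^n`. -/
structure PartialBoolFun (n : ℕ) where
  dom : Set (Fin n → Bool)
  val : dom → Bool

/-- The Hamming weight of a bit string. -/
def weight {n : ℕ} (x : Fin n → Bool) : ℕ :=
  (Finset.univ.filter fun i => x i = true).card

/-- `MAJORITY-OR-NONE`: defined on the strings of Hamming weight `0` or at least `n / 2`, with
value `0` in the former case and `1` otherwise. -/
def majorityOrNone (n : ℕ) : PartialBoolFun n where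
  dom := {x | weight x = 0 ∨ (n : ℝ) / 2 ≤ weight x}
  val := fun x => if weight x.1 = 0 then false else true

/-! ### Approximate and rational degree, in the `{-1,1}` representation -/

/-- The `{-1,1}` encoding of a bit: `0` is sent to `1` and `1` is sent to `-1`. -/
def sgn (b : Bool) : ℝ := if b then -1 else 1

/-- The value of a real polynomial at the point of `{-1,1}^n` that encodes the bit string `x`. -/
def evalSgn {n : ℕ} (p : MvPolynomial (Fin n) ℝ) (x : Fin n → Bool) : ℝ :=
  MvPolynomial.eval (fun i => sgn (x i)) p

/-- `p` approximates `f` to within `ε` on the domain of `f`, and is bounded by `1` in absolute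
value on the whole cube. -/
def Approximates {n : ℕ} (ε : ℝ) (f : PartialBoolFun n) (p : MvPolynomial (Fin n) ℝ) : Prop :=
  (∀ x : f.dom, |evalSgn p x.1 - sgn (f.val x)| ≤ ε) ∧ ∀ x : Fin n → Bool, |evalSgn p x| ≤ 1

/-- The `ε`-approximate degree (`⊤` if there is no approximating polynomial). -/
def approxDegree {n : ℕ} (ε : ℝ) (f : PartialBoolFun n) : ℕ∞ :=
  ⨅ (p : MvPolynomial (Fin n) ℝ) (_ : Approximates ε f p), (p.totalDegree : ℕ∞)

/-- `p / q` is an `ε`-approximate rational representation of `f`. -/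
def RationallyApproximates {n : ℕ} (ε : ℝ) (f : PartialBoolFun n)
    (p q : MvPolynomial (Fin n) ℝ) : Prop :=
  ∀ x : f.dom, evalSgn q x.1 ≠ 0 ∧ |sgn (f.val x) - evalSgn p x.1 / evalSgn q x.1| ≤ ε

/-- The `ε`-approximate rational degree. -/
def approxRationalDegree {n : ℕ} (ε : ℝ) (f : PartialBoolFun n) : ℕ∞ :=
  ⨅ (p : MvPolynomial (Fin n) ℝ) (q : MvPolynomial (Fin n) ℝ)
    (_ : RationallyApproximates ε f p q), ((max p.totalDegree q.totalDegree : ℕ) : ℕ∞)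

/-- The rational degree. -/
def rationalDegree {n : ℕ} (f : PartialBoolFun n) : ℕ∞ := approxRationalDegree 0 f

/-! ### Randomized query complexity with one-sided error -/

/-- Deterministic decision trees querying the bits of an `n`-bit string. -/
inductive DecisionTree (n : ℕ) : Type
  | leaf (b : Bool) : DecisionTree n
  | query (i : Fin n) (t₀ t₁ : DecisionTree n) : DecisionTree n

/-- The output of a decision tree. -/
def DecisionTree.eval {n : ℕ} (x : Fin n → Bool) : DecisionTree n → Bool
  | .leaf b => b
  | .query i t₀ t₁ => if x i = true then t₁.eval x else t₀.eval x

/-- The depth of a decision tree: the number of queries in the worst case. -/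
def DecisionTree.depth {n : ℕ} : DecisionTree n → ℕ
  | .leaf _ => 0
  | .query _ t₀ t₁ => max t₀.depth t₁.depth + 1

/-- Some randomized algorithm, that is, a probability distribution on decision trees of depth at
most `T`, always outputs `0` where `f` is `0`, and outputs `1` with probability at least `1 - ε`
where `f` is `1`. -/
def OneSidedComputable {n : ℕ} (ε : ℝ) (f : PartialBoolFun n) (T : ℕ) : Prop :=
  ∃ μ : PMF (DecisionTree n), (∀ t ∈ μ.support, t.depth ≤ T) ∧
    ∀ x : f.dom,
      (f.val x = false → μ.map (DecisionTree.eval x.1) false = 1) ∧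
      (f.val x = true → 1 - ε ≤ (μ.map (DecisionTree.eval x.1) true).toReal)

/-- The randomized query complexity with one-sided error `ε` (`RP` query complexity). -/
def oneSidedQueryComplexity {n : ℕ} (ε : ℝ) (f : PartialBoolFun n) : ℕ∞ :=
  ⨅ (T : ℕ) (_ : OneSidedComputable ε f T), (T : ℕ∞)

/-! ### Quantum query complexity, without and with post-selection -/

/-- Labels of the computational basis: the index register and the target qubit of the query, the
output qubit `a`, the post-selection qubit `b`, and `m` further work qubits. -/
abbrev Label (n m : ℕ) : Type := Fin n × Bool × Bool × Bool × (Fin m → Bool)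

/-- The output qubit of a basis state. -/
def Label.a {n m : ℕ} (z : Label n m) : Bool := z.2.2.1

/-- The post-selection qubit of a basis state. -/
def Label.b {n m : ℕ} (z : Label n m) : Bool := z.2.2.2.1

/-- The action of a query to `x` on basis states: `|i⟩|c⟩ ↦ |i⟩|c ⊕ x_i⟩` on the query registers,
and the identity on the other qubits. -/
def queryLabel {n m : ℕ} (x : Fin n → Bool) (z : Label n m) : Label n m :=
  (z.1, xor z.2.1 (x z.1), z.2.2)

/-- The query unitary, as a matrix in the computational basis. -/
def queryMatrix {n m : ℕ} (x : Fin n → Bool) : Matrix (Label n m) (Label n m) ℂ :=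
  Matrix.of fun y z => if y = queryLabel x z then 1 else 0

/-- A quantum algorithm with `T` queries and `m` work qubits: it starts in a fixed computational
basis state and applies the unitaries `U 0, U 1, …, U T`, none of which depends on the input, with
a query between any two consecutive ones. Only the first `T + 1` terms of the sequence `U`
matter. -/
structure QuantumAlgorithm (n T m : ℕ) where
  start : Label n m
  U : ℕ → Matrix.unitaryGroup (Label n m) ℂ

namespace QuantumAlgorithm

/-- The state after `U t`, hence after `t` queries, on input `x`. -/
def state {n T m : ℕ} (A : QuantumAlgorithm n T m) (x : Fin n → Bool) : ℕ → Label n m → ℂ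
  | 0 => (A.U 0).1 *ᵥ Pi.single A.start 1
  | t + 1 => (A.U (t + 1)).1 *ᵥ (queryMatrix x *ᵥ A.state x t)

/-- The probability that measuring the final state in the computational basis gives an outcome
in `E`. -/
def prob {n T m : ℕ} (A : QuantumAlgorithm n T m) (x : Fin n → Bool) (E : Label n m → Bool) : ℝ :=
  ∑ z, if E z = true then ‖A.state x T z‖ ^ 2 else 0

/-- The algorithm computes `f` with error at most `ε`. -/
def Computes {n T m : ℕ} (A : QuantumAlgorithm n T m) (ε : ℝ) (f : PartialBoolFun n) : Prop :=
  ∀ x : f.dom, 1 - ε ≤ A.prob x.1 fun z => z.a == f.val x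

/-- The conditional probability `Pr[a = 1 | b = 1]` on input `x`. -/
def postProb {n T m : ℕ} (A : QuantumAlgorithm n T m) (x : Fin n → Bool) : ℝ :=
  A.prob x (fun z => z.a && z.b) / A.prob x (fun z => z.b)

/-- The algorithm computes `f` with post-selection, with error at most `ε`. -/
def PostComputes {n T m : ℕ} (A : QuantumAlgorithm n T m) (ε : ℝ) (f : PartialBoolFun n) : Prop :=
  ∀ x : f.dom, 0 < A.prob x.1 (fun z => z.b) ∧
    (f.val x = true → 1 - ε ≤ A.postProb x.1) ∧ (f.val x = false → A.postProb x.1 ≤ ε)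

end QuantumAlgorithm

/-- The `ε`-error quantum query complexity. -/
def quantumQueryComplexity {n : ℕ} (ε : ℝ) (f : PartialBoolFun n) : ℕ∞ :=
  ⨅ (T : ℕ) (_ : ∃ (m : ℕ) (A : QuantumAlgorithm n T m), A.Computes ε f), (T : ℕ∞)

/-- The `ε`-error post-selected quantum query complexity; the case `ε = 0` is the zero-error
post-selected quantum query complexity. -/
def postQuantumQueryComplexity {n : ℕ} (ε : ℝ) (f : PartialBoolFun n) : ℕ∞ :=
  ⨅ (T : ℕ) (_ : ∃ (m : ℕ) (A : QuantumAlgorithm n T m), A.PostComputes ε f), (T : ℕ∞)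

end BoolQuery

end

/-! Both lower bounds rest on `HasDegreeLE.half_le`. Let `g` vanish at every point of weight at
least `n / 2` but not at the origin. Multiplying `g` by the factors `|x| - j` for `1 ≤ j < n / 2`
kills the intermediate weights too, so the product is supported at the origin alone. Such a function
correlates with parity and so has degree at least `n`; the extra factors account for less than half
of it. For rational degree, take `g = p + q`. For zero-error post-selection, take `g` to be one
amplitude with `a = 0`, `b = 1`; it has degree at most the number of queries
(`QuantumAlgorithm.hasDegreeLE_state`). Amplitudes are complex, hence the general field. The upper
bounds use that a random index hits a one with probability at least `1/2` on heavy inputs and never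
at the origin. -/

namespace BoolQuery

/-! ### Degree of functions on the cube, and orthogonality to parity. -/

section Degree

variable {R : Type*} [Field R] {n : ℕ}

/-- The `{-1,1}` encoding of a bit in an arbitrary field. -/
def signOf (R : Type*) [Field R] (b : Bool) : R := if b then -1 else 1

/-- A function on the cube is represented by a polynomial of total degree at most `d` in the
`{-1,1}` encoding of the bits. -/
def HasDegreeLE (d : ℕ) (g : (Fin n → Bool) → R) : Prop :=
  ∃ P : MvPolynomial (Fin n) R, P.totalDegree ≤ d ∧
    ∀ x, MvPolynomial.eval (fun i => signOf R (x i)) P = g x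

theorem HasDegreeLE.const (d : ℕ) (a : R) : HasDegreeLE d fun _ : Fin n → Bool => a :=
  ⟨MvPolynomial.C a, by simp, by simp⟩

theorem HasDegreeLE.signOf_apply (i : Fin n) :
    HasDegreeLE 1 fun x : Fin n → Bool => signOf R (x i) :=
  ⟨MvPolynomial.X i, by simp, by simp⟩

theorem HasDegreeLE.add {d : ℕ} {g h : (Fin n → Bool) → R} (hg : HasDegreeLE d g)
    (hh : HasDegreeLE d h) : HasDegreeLE d fun x => g x + h x := by
  obtain ⟨P, hP, hPg⟩ := hg
  obtain ⟨Q, hQ, hQh⟩ := hh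
  exact ⟨P + Q, (MvPolynomial.totalDegree_add P Q).trans (max_le hP hQ), by simp [hPg, hQh]⟩

theorem HasDegreeLE.mul {d e : ℕ} {g h : (Fin n → Bool) → R} (hg : HasDegreeLE d g)
    (hh : HasDegreeLE e h) : HasDegreeLE (d + e) fun x => g x * h x := by
  obtain ⟨P, hP, hPg⟩ := hg
  obtain ⟨Q, hQ, hQh⟩ := hh
  exact ⟨P * Q, (MvPolynomial.totalDegree_mul P Q).trans (add_le_add hP hQ), by simp [hPg, hQh]⟩

theorem HasDegreeLE.const_mul {d : ℕ} {g : (Fin n → Bool) → R} (a : R) (hg : HasDegreeLE d g) :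
    HasDegreeLE d fun x => a * g x := by
  simpa using (HasDegreeLE.const 0 a).mul hg

theorem HasDegreeLE.sum {ι : Type*} (s : Finset ι) {d : ℕ} {g : ι → (Fin n → Bool) → R}
    (hg : ∀ j ∈ s, HasDegreeLE d (g j)) : HasDegreeLE d fun x => ∑ j ∈ s, g j x := by
  induction s using Finset.cons_induction with
  | empty => simpa using HasDegreeLE.const d 0
  | cons a s ha ih =>
    simp only [Finset.sum_cons]
    exact (hg a (by simp)).add (ih fun j hj => hg j (by simp [hj]))

theorem HasDegreeLE.prod {ι : Type*} (s : Finset ι) {d : ℕ} {g : ι → (Fin n → Bool) → R}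
    (hg : ∀ j ∈ s, HasDegreeLE d (g j)) : HasDegreeLE (s.card * d) fun x => ∏ j ∈ s, g j x := by
  induction s using Finset.cons_induction with
  | empty => simpa using HasDegreeLE.const 0 1
  | cons a s ha ih =>
    simp only [Finset.prod_cons, Finset.card_cons]
    rw [add_mul, one_mul, add_comm]
    exact (hg a (by simp)).mul (ih fun j hj => hg j (by simp [hj]))

/-- A function of degree less than `n` is orthogonal to the parity function. -/
theorem HasDegreeLE.sum_parity_mul_eq_zero {d : ℕ} {g : (Fin n → Bool) → R}
    (hg : HasDegreeLE d g) (hd : d < n) : ∑ x, (∏ i, signOf R (x i)) * g x = 0 := by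
  obtain ⟨P, hP, hPg⟩ := hg
  simp only [← hPg, MvPolynomial.eval_eq, Finset.mul_sum]
  rw [Finset.sum_comm]
  refine Finset.sum_eq_zero fun e he => ?_
  -- A monomial of degree below `n` misses some variable; multiplied by parity it is linear in that
  -- variable, so summing over that bit gives `1 + (-1) = 0`.
  obtain ⟨i, hi⟩ : ∃ i, e i = 0 := by
    by_contra! h
    have h1 : ∑ i, e i ≤ d := by
      refine le_trans ?_ hP
      simpa [Finsupp.sum_fintype] using MvPolynomial.le_totalDegree he
    have h2 : ∑ _i : Fin n, 1 ≤ ∑ i, e i :=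
      Finset.sum_le_sum fun i _ => Nat.one_le_iff_ne_zero.2 (h i)
    simp at h2
    omega
  have h : ∀ x : Fin n → Bool, (∏ i, signOf R (x i)) *
      (MvPolynomial.coeff e P * ∏ i ∈ e.support, signOf R (x i) ^ e i) =
      MvPolynomial.coeff e P * ∏ i, signOf R (x i) ^ (e i + 1) := by
    intro x
    rw [Finset.prod_subset (Finset.subset_univ e.support)]
    · simp only [pow_succ, Finset.prod_mul_distrib]; ring
    · intro j _ hj
      simp [Finsupp.notMem_support_iff.1 hj]
  simp only [h, ← Finset.mul_sum]
  rw [← Fintype.piFinset_univ, ← Finset.prod_univ_sum (fun _ => Finset.univ)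
    (fun i b => signOf R b ^ (e i + 1))]
  rw [Finset.prod_eq_zero (Finset.mem_univ i) (by simp [signOf, hi]), mul_zero]

theorem hasDegreeLE_weight [CharZero R] :
    HasDegreeLE 1 fun x : Fin n → Bool => (weight x : R) := by
  have h : (fun x : Fin n → Bool => (weight x : R)) =
      fun x => ∑ i, (1 / 2 + (-1 / 2) * signOf R (x i)) := by
    funext x
    rw [weight, Finset.card_filter, Nat.cast_sum]
    refine Finset.sum_congr rfl fun i _ => ?_
    cases x i <;> simp [signOf] <;> norm_num
  rw [h]
  exact HasDegreeLE.sum _ fun i _ =>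
    (HasDegreeLE.const 1 _).add ((HasDegreeLE.signOf_apply i).const_mul _)

theorem weight_eq_zero_iff {x : Fin n → Bool} : weight x = 0 ↔ x = fun _ => false := by
  simp [weight, Finset.filter_eq_empty_iff, funext_iff]

/-- A polynomial that vanishes at all points of weight at least `n / 2` but not at the origin has
degree at least `n / 2`. -/
theorem HasDegreeLE.half_le [CharZero R] {d : ℕ} {g : (Fin n → Bool) → R} (hg : HasDegreeLE d g)
    (hn : 1 ≤ n) (hheavy : ∀ x, n ≤ 2 * weight x → g x = 0) (hzero : g (fun _ => false) ≠ 0) :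
    (n + 1) / 2 ≤ d := by
  by_contra! hd
  -- The range is exactly the positive weights `j` with `2 * j < n`, where nothing is known about
  -- `g`.
  have hp : HasDegreeLE ((Finset.Icc 1 ((n - 1) / 2)).card * 1)
      fun x : Fin n → Bool => ∏ j ∈ Finset.Icc 1 ((n - 1) / 2), ((weight x : R) + -(j : R)) :=
    HasDegreeLE.prod _ fun j _ => hasDegreeLE_weight.add (HasDegreeLE.const 1 _)
  have key := (hp.mul hg).sum_parity_mul_eq_zero (by simp; omega)
  rw [Finset.sum_eq_single (fun _ => false)] at key
  · have hw : weight (fun _ : Fin n => false) = 0 := weight_eq_zero_iff.2 rfl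
    simp only [hw, mul_eq_zero, hzero, or_false, Finset.prod_eq_zero_iff] at key
    rcases key with ⟨i, -, hi⟩ | ⟨j, hj, hj0⟩
    · simp [signOf] at hi
    · simp at hj hj0; omega
  · intro x _ hx
    have hw : weight x ≠ 0 := fun h => hx (weight_eq_zero_iff.1 h)
    by_cases h : n ≤ 2 * weight x
    · simp [hheavy x h]
    · rw [Finset.prod_eq_zero (i := weight x)
        (Finset.mem_Icc.2 ⟨by omega, by omega⟩) (by simp)]
      simp
  · simp

end Degree

/-! ### The function's domain and values, and its rational degree. -/

theorem mem_majorityOrNone_dom {n : ℕ} {x : Fin n → Bool} :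
    x ∈ (majorityOrNone n).dom ↔ weight x = 0 ∨ n ≤ 2 * weight x := by
  have : (n : ℝ) / 2 ≤ weight x ↔ n ≤ 2 * weight x := by
    rw [div_le_iff₀ two_pos, mul_comm]; exact_mod_cast Iff.rfl
  simp [majorityOrNone, this]

theorem majorityOrNone_val_eq_false {n : ℕ} {x : (majorityOrNone n).dom} :
    (majorityOrNone n).val x = false ↔ weight x.1 = 0 := by
  simp [majorityOrNone]

theorem majorityOrNone_val_eq_true {n : ℕ} {x : (majorityOrNone n).dom} :
    (majorityOrNone n).val x = true ↔ weight x.1 ≠ 0 := by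
  simp [majorityOrNone]

theorem majorityOrNone_le_two_mul_weight {n : ℕ} {x : (majorityOrNone n).dom}
    (hx : (majorityOrNone n).val x = true) : n ≤ 2 * weight x.1 :=
  (mem_majorityOrNone_dom.1 x.2).resolve_left (majorityOrNone_val_eq_true.1 hx)

theorem half_le_rationalDegree {n : ℕ} (hn : 1 ≤ n) :
    (((n + 1) / 2 : ℕ) : ℕ∞) ≤ rationalDegree (majorityOrNone n) := by
  refine le_iInf fun p => le_iInf fun q => le_iInf fun h => Nat.cast_le.2 ?_
  have h0 : (fun _ => false) ∈ (majorityOrNone n).dom :=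
    mem_majorityOrNone_dom.2 (Or.inl (weight_eq_zero_iff.2 rfl))
  have hpq : ∀ x : (majorityOrNone n).dom, evalSgn q x.1 ≠ 0 ∧
      evalSgn p x.1 = sgn ((majorityOrNone n).val x) * evalSgn q x.1 := by
    intro x
    obtain ⟨hq, hx⟩ := h x
    have := sub_eq_zero.1 (abs_nonpos_iff.1 hx)
    exact ⟨hq, by rw [this, div_mul_cancel₀ _ hq]⟩
  -- Since `p = f q` on the domain, `p + q = (f + 1) q` vanishes where `f = -1` and equals `2 q ≠ 0`
  -- at the origin.
  have hg : HasDegreeLE (max p.totalDegree q.totalDegree)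
      fun x : Fin n → Bool => evalSgn (p + q) x :=
    ⟨p + q, MvPolynomial.totalDegree_add p q, fun x => rfl⟩
  refine hg.half_le hn (fun x hx => ?_) ?_
  · have hd := mem_majorityOrNone_dom.2 (Or.inr hx)
    have hv : (majorityOrNone n).val ⟨x, hd⟩ = true :=
      majorityOrNone_val_eq_true.2 (by simp only; omega)
    have := (hpq ⟨x, hd⟩).2
    rw [hv] at this
    simp only [evalSgn, map_add] at this ⊢
    rw [this]; simp [sgn]
  · have hv : (majorityOrNone n).val ⟨_, h0⟩ = false :=
      majorityOrNone_val_eq_false.2 (weight_eq_zero_iff.2 rfl)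
    have := hpq ⟨_, h0⟩
    rw [hv] at this
    simp only [evalSgn, map_add] at this ⊢
    rw [this.2]
    simpa [sgn] using this.1

/-! ### Unitary matrices: involutive permutations and state preparation. -/

section Permutation

variable {ι : Type*} [Fintype ι] [DecidableEq ι]

/-- The permutation matrix of an involution permutes the entries of a vector. -/
theorem involutive_matrix_mulVec {σ : ι → ι} (hσ : Function.Involutive σ) (ψ : ι → ℂ) (y : ι) :
    ((Matrix.of fun y z => if y = σ z then 1 else 0 : Matrix ι ι ℂ) *ᵥ ψ) y = ψ (σ y) := by
  have h : ∀ z, y = σ z ↔ σ y = z := fun z => by rw [eq_comm, hσ.eq_iff, eq_comm]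
  simp [Matrix.mulVec, dotProduct, h]

theorem involutive_matrix_mem_unitaryGroup {σ : ι → ι} (hσ : Function.Involutive σ) :
    (Matrix.of fun y z => if y = σ z then 1 else 0 : Matrix ι ι ℂ) ∈ Matrix.unitaryGroup ι ℂ := by
  rw [Matrix.mem_unitaryGroup_iff]
  ext y z
  have h : ∀ v w, v = σ w ↔ σ v = w := fun v w => by rw [eq_comm, hσ.eq_iff, eq_comm]
  simp only [Matrix.mul_apply, Matrix.star_apply, Matrix.of_apply, h, Matrix.one_apply]
  simp [hσ.injective.eq_iff]

/-- Every unit vector is the image of a given basis vector under some unitary matrix. -/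
theorem exists_unitary_mulVec_single (s : ι) {φ : ι → ℂ} (hφ : ∑ z, ‖φ z‖ ^ 2 = 1) :
    ∃ U : Matrix.unitaryGroup ι ℂ, U.1 *ᵥ Pi.single s 1 = φ := by
  have hn : ‖WithLp.toLp 2 φ‖ = 1 := by
    rw [EuclideanSpace.norm_eq]; simp [hφ]
  -- The one-vector family at index `s` extends to an orthonormal basis; the matrix with these basis
  -- vectors as columns has `φ` as column `s`.
  have ho : Orthonormal ℂ (Set.domRestrict {s} fun _ : ι => WithLp.toLp 2 φ) := by
    refine ⟨fun _ => hn, fun i j hij => (hij (Subsingleton.elim i j)).elim⟩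
  obtain ⟨b, hb⟩ := ho.exists_orthonormalBasis_extension_of_card_eq (by simp)
  refine ⟨⟨_, OrthonormalBasis.toMatrix_orthonormalBasis_mem_unitary
    (EuclideanSpace.basisFun ι ℂ) b⟩, ?_⟩
  ext z
  simp [Module.Basis.toMatrix_apply, hb s]

end Permutation

/-! ### The polynomial method for amplitudes, and post-selection. -/

theorem queryLabel_involutive {n m : ℕ} (x : Fin n → Bool) :
    Function.Involutive (queryLabel (m := m) x) := by
  rintro ⟨i, c, r⟩
  simp [queryLabel]

theorem queryMatrix_mulVec {n m : ℕ} (x : Fin n → Bool) (ψ : Label n m → ℂ) (y : Label n m) :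
    (queryMatrix x *ᵥ ψ) y = ψ (queryLabel x y) :=
  involutive_matrix_mulVec (queryLabel_involutive x) ψ y

/-- After `t` queries the amplitudes are polynomials of degree at most `t` in the input. -/
theorem QuantumAlgorithm.hasDegreeLE_state {n T m : ℕ} (A : QuantumAlgorithm n T m) (t : ℕ)
    (z : Label n m) : HasDegreeLE t fun x => A.state x t z := by
  induction t generalizing z with
  | zero => exact HasDegreeLE.const 0 _
  | succ t ih =>
    simp only [QuantumAlgorithm.state, Matrix.mulVec, dotProduct]
    refine HasDegreeLE.sum _ fun y _ => HasDegreeLE.const_mul _ ?_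
    -- A query keeps the amplitude at `y` or takes that of its target-flipped partner; the
    -- indicators of the two values of the bit are `(1 ± sign) / 2`, so the degree grows by one.
    have h : (fun x => ∑ w, queryMatrix x y w * A.state x t w) = fun x =>
        (1 / 2 + 1 / 2 * signOf ℂ (x y.1)) * A.state x t y +
        (1 / 2 + (-1 / 2) * signOf ℂ (x y.1)) * A.state x t (y.1, !y.2.1, y.2.2) := by
      funext x
      refine (queryMatrix_mulVec x (A.state x t) y).trans ?_
      obtain ⟨i, c, r⟩ := y
      cases hx : x i <;> simp [queryLabel, signOf, hx] <;> norm_num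
    rw [h, add_comm t]
    exact (((HasDegreeLE.const 1 _).add ((HasDegreeLE.signOf_apply _).const_mul _)).mul (ih _)).add
      (((HasDegreeLE.const 1 _).add ((HasDegreeLE.signOf_apply _).const_mul _)).mul (ih _))

/-- Zero error on heavy inputs forces every amplitude with `a = 0`, `b = 1` to vanish there, while
at the origin one of them is nonzero. Using an amplitude rather than a probability avoids doubling
the degree. -/
theorem half_le_postQuantumQueryComplexity {n : ℕ} (hn : 1 ≤ n) :
    (((n + 1) / 2 : ℕ) : ℕ∞) ≤ postQuantumQueryComplexity 0 (majorityOrNone n) := by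
  refine le_iInf fun T => le_iInf fun ⟨m, A, hA⟩ => Nat.cast_le.2 ?_
  have split : ∀ x, A.prob x (fun z => z.b) =
      A.prob x (fun z => z.a && z.b) + A.prob x (fun z => !z.a && z.b) := by
    intro x
    simp only [QuantumAlgorithm.prob, ← Finset.sum_add_distrib]
    refine Finset.sum_congr rfl fun z _ => ?_
    by_cases ha : z.a = true <;> by_cases hb : z.b = true <;> simp [ha, hb]
  have nonneg : ∀ x (z : Label n m),
      0 ≤ if (!z.a && z.b) = true then ‖A.state x T z‖ ^ 2 else 0 := by
    intro x z; split_ifs <;> positivity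
  have h0 : (fun _ => false) ∈ (majorityOrNone n).dom :=
    mem_majorityOrNone_dom.2 (Or.inl (weight_eq_zero_iff.2 rfl))
  obtain ⟨hpos, -, hzero⟩ := hA ⟨_, h0⟩
  have hzero := hzero (majorityOrNone_val_eq_false.2 (weight_eq_zero_iff.2 rfl))
  have hne : A.prob (fun _ => false) (fun z => !z.a && z.b) ≠ 0 := by
    intro h
    have := split fun _ => false
    rw [h, add_zero] at this
    simp only [QuantumAlgorithm.postProb, ← this] at hzero
    rw [div_self hpos.ne'] at hzero
    norm_num at hzero
  -- The label is fixed once, from the origin; its amplitude as a function of the input is the `g`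
  -- of `half_le`.
  obtain ⟨z, -, hz⟩ := Finset.exists_ne_zero_of_sum_ne_zero hne
  have hzE : (!z.a && z.b) = true := by by_contra h; simp [h] at hz
  refine (A.hasDegreeLE_state T z).half_le hn (fun x hx => ?_) ?_
  · have hd := mem_majorityOrNone_dom.2 (Or.inr hx)
    obtain ⟨hp, h1, -⟩ := hA ⟨x, hd⟩
    have h1 := h1 (majorityOrNone_val_eq_true.2 (by simp only; omega))
    simp only [QuantumAlgorithm.postProb] at h1
    rw [sub_zero, one_le_div hp] at h1
    have hs := split x
    have hE : A.prob x (fun z => !z.a && z.b) = 0 :=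
      le_antisymm (by simp only at h1; linarith) (Finset.sum_nonneg fun z _ => nonneg x z)
    have := (Finset.sum_eq_zero_iff_of_nonneg fun z _ => nonneg x z).1 hE z (Finset.mem_univ z)
    simpa [hzE] using this
  · intro h
    simp [h] at hz

/-! ### Upper bounds for randomized query complexity and approximate degree. -/

/-- The tree computing the disjunction of two bits. -/
def orTree {n : ℕ} (ij : Fin n × Fin n) : DecisionTree n :=
  .query ij.1 (.query ij.2 (.leaf false) (.leaf true)) (.leaf true)

theorem eval_orTree {n : ℕ} (x : Fin n → Bool) (ij : Fin n × Fin n) :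
    (orTree ij).eval x = (x ij.1 || x ij.2) := by
  cases h : x ij.1 <;> cases h' : x ij.2 <;> simp [orTree, DecisionTree.eval, h, h']

theorem weight_add_card_filter_false {n : ℕ} (x : Fin n → Bool) :
    weight x + (Finset.univ.filter fun i => x i = false).card = n := by
  simpa [weight] using Finset.card_filter_add_card_filter_not (s := Finset.univ)
    (fun i : Fin n => x i = true)

/-- Two independent samples both miss the ones of a heavy input with probability at most `1/4 ≤
1/3`; a single sample could fail with probability `1/2`. Sampling with replacement makes the failure
probability exactly `(k / n)^2`, with `k` the number of zero bits. -/
theorem oneSidedComputable_majorityOrNone {n : ℕ} (hn : 1 ≤ n) :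
    OneSidedComputable (1 / 3) (majorityOrNone n) 2 := by
  have : Nonempty (Fin n) := ⟨⟨0, hn⟩⟩
  refine ⟨(PMF.uniformOfFintype (Fin n × Fin n)).map orTree, ?_, fun x => ⟨fun hx => ?_,
    fun hx => ?_⟩⟩
  · intro t ht
    obtain ⟨ij, -, rfl⟩ := (PMF.mem_support_map_iff _ _ _).1 ht
    simp [orTree, DecisionTree.depth]
  · have h0 := weight_eq_zero_iff.1 (majorityOrNone_val_eq_false.1 hx)
    have : DecisionTree.eval x.1 ∘ orTree = Function.const _ false := by
      funext ij; simp [eval_orTree, h0]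
    rw [PMF.map_comp, this, PMF.map_const]
    simp
  · have hw := majorityOrNone_le_two_mul_weight hx
    have hsum := weight_add_card_filter_false x.1
    set k := (Finset.univ.filter fun i => x.1 i = false).card
    have hmass : ∀ b, (((PMF.uniformOfFintype (Fin n × Fin n)).map orTree).map
        (DecisionTree.eval x.1) b) =
        (Finset.univ.filter fun ij : Fin n × Fin n => (x.1 ij.1 || x.1 ij.2) = b).card /
          ((n * n : ℕ) : ENNReal) := by
      intro b
      rw [PMF.map_comp, PMF.map_apply, tsum_fintype]
      simp [eval_orTree, Finset.sum_ite, eq_comm (a := b), div_eq_mul_inv]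
    have hfalse : (Finset.univ.filter fun ij : Fin n × Fin n =>
        (x.1 ij.1 || x.1 ij.2) = false).card = k * k := by
      rw [← Finset.card_product, ← Finset.filter_product, Finset.univ_product_univ]
      simp
    have htrue := Finset.card_filter_add_card_filter_not (s := Finset.univ)
      (fun ij : Fin n × Fin n => (x.1 ij.1 || x.1 ij.2) = true)
    simp only [Bool.not_eq_true, hfalse, Finset.card_univ, Fintype.card_prod,
      Fintype.card_fin] at htrue
    rw [hmass]
    have hn' : (0 : ℝ) < n := by exact_mod_cast hn
    rw [ENNReal.toReal_div, ENNReal.toReal_natCast, ENNReal.toReal_natCast,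
      le_div_iff₀ (by push_cast; positivity)]
    have h1 := congrArg (Nat.cast (R := ℝ)) htrue
    have h2 : (2 * k : ℝ) ≤ n := by exact_mod_cast (by omega : 2 * k ≤ n)
    have h3 : (0 : ℝ) ≤ k := Nat.cast_nonneg k
    push_cast at h1 ⊢
    nlinarith

/-- The witness is `2 u^3 - 1` with `u = 1 - |x| / n` in `[0, 1]`: it is `1` at the origin and lies
in `[-1, -3/4]` on heavy inputs, where `u ≤ 1/2`. A square in place of the cube would only guarantee
error `1/2`. -/
theorem approxDegree_majorityOrNone_le {n : ℕ} (hn : 1 ≤ n) :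
    approxDegree (1 / 3) (majorityOrNone n) ≤ 3 := by
  have hn' : (0 : ℝ) < n := by exact_mod_cast hn
  obtain ⟨S, hS, hSx⟩ : HasDegreeLE 1 fun x : Fin n → Bool => 1 + (-1 / (n : ℝ)) * weight x :=
    (HasDegreeLE.const 1 _).add (hasDegreeLE_weight.const_mul _)
  have hev : ∀ x : Fin n → Bool, evalSgn (MvPolynomial.C 2 * S ^ 3 - 1) x =
      2 * (1 + (-1 / (n : ℝ)) * weight x) ^ 3 - 1 := by
    intro x
    have h : evalSgn S x = 1 + (-1 / (n : ℝ)) * weight x := hSx x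
    rw [← h]
    simp [evalSgn]
  have hle : ∀ x : Fin n → Bool, 0 ≤ 1 + (-1 / (n : ℝ)) * weight x := by
    intro x
    have : (weight x : ℝ) ≤ n := by
      exact_mod_cast (by have := weight_add_card_filter_false x; omega : weight x ≤ n)
    have : (weight x : ℝ) / n ≤ 1 := (div_le_one hn').2 this
    have e : (-1 / (n : ℝ)) * weight x = -((weight x : ℝ) / n) := by ring
    linarith
  have hcube : ∀ u : ℝ, 0 ≤ u → 0 ≤ 2 * u ^ 3 := fun u hu => by positivity
  refine (iInf₂_le (MvPolynomial.C 2 * S ^ 3 - 1) ⟨fun x => ?_, fun x => ?_⟩).trans ?_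
  · have h : (MvPolynomial.C 2 * S ^ 3 - 1).totalDegree ≤ 3 := by
      refine (MvPolynomial.totalDegree_sub _ _).trans (max_le ?_ (by simp))
      refine (MvPolynomial.totalDegree_mul _ _).trans ?_
      have := MvPolynomial.totalDegree_pow S 3
      simp only [MvPolynomial.totalDegree_C]
      omega
    exact_mod_cast h
  · rw [hev]
    cases hv : (majorityOrNone n).val x
    · rw [majorityOrNone_val_eq_false.1 hv]
      norm_num [sgn]
    · have hw : (n : ℝ) ≤ 2 * weight x.1 := by
        exact_mod_cast majorityOrNone_le_two_mul_weight hv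
      have h1 : (1 : ℝ) / 2 ≤ (weight x.1 : ℝ) / n := by
        rw [div_le_div_iff₀ two_pos hn']; linarith
      have e : (-1 / (n : ℝ)) * weight x.1 = -((weight x.1 : ℝ) / n) := by ring
      have h2 : 1 + (-1 / (n : ℝ)) * weight x.1 ≤ 1 / 2 := by linarith
      have h3 := pow_le_pow_left₀ (hle x.1) h2 3
      have h4 := hcube _ (hle x.1)
      simp only [sgn, if_true]
      rw [abs_le]
      constructor <;> linarith
  · rw [hev, abs_le]
    have h2 : 1 + (-1 / (n : ℝ)) * weight x ≤ 1 := by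
      have : 0 ≤ (weight x : ℝ) / n := by positivity
      have e : (-1 / (n : ℝ)) * weight x = -((weight x : ℝ) / n) := by ring
      linarith
    have h3 := pow_le_pow_left₀ (hle x) h2 3
    have h4 := hcube _ (hle x)
    constructor <;> linarith

/-! ### A one-query quantum algorithm. -/

/-- The final step of the one-query algorithm: the disjunction of the queried bit and of the
flag `b` is added to the output qubit. -/
def orLabel {n m : ℕ} (z : Label n m) : Label n m :=
  (z.1, z.2.1, xor z.2.2.1 (z.2.1 || z.2.2.2.1), z.2.2.2)

theorem orLabel_involutive {n m : ℕ} : Function.Involutive (orLabel (n := n) (m := m)) := by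
  rintro ⟨i, c, a, b, r⟩
  simp [orLabel]

/-- The initial state of the one-query algorithm: a uniformly random index, and a flag `b` that
is set with probability `1 / 3`. -/
noncomputable def initialState (n : ℕ) (z : Label n 0) : ℂ :=
  if z.2.1 = false ∧ z.2.2.1 = false then
    (Real.sqrt (if z.2.2.2.1 = true then 1 / (3 * n) else 2 / (3 * n)) : ℝ)
  else 0

theorem norm_initialState_sq {n : ℕ} (z : Label n 0) : ‖initialState n z‖ ^ 2 =
    if z.2.1 = false ∧ z.2.2.1 = false then
      (if z.2.2.2.1 = true then 1 / (3 * n) else 2 / (3 * n) : ℝ) else 0 := by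
  unfold initialState
  split_ifs
  · rw [Complex.norm_real, Real.norm_eq_abs, sq_abs, Real.sq_sqrt (by positivity)]
  · rw [Complex.norm_real, Real.norm_eq_abs, sq_abs, Real.sq_sqrt (by positivity)]
  · simp

/-- The flag balances the two errors: the output is `1` with probability `1/3` at the origin and at
least `1/2 + 1/2 * 1/3 = 2/3` on heavy inputs. No interference is involved, since after preparation
every operation permutes basis states. -/
theorem exists_computes_majorityOrNone {n : ℕ} (hn : 1 ≤ n) :
    ∃ A : QuantumAlgorithm n 1 0, A.Computes (1 / 3) (majorityOrNone n) := by
  have hn' : (0 : ℝ) < n := by exact_mod_cast hn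
  have hunit : ∑ z, ‖initialState n z‖ ^ 2 = 1 := by
    simp [norm_initialState_sq, Fintype.sum_prod_type]
    field_simp
    norm_num
  obtain ⟨U, hU⟩ := exists_unitary_mulVec_single
    ((⟨0, hn⟩, false, false, false, fun _ => false) : Label n 0) hunit
  let V : Matrix.unitaryGroup (Label n 0) ℂ :=
    ⟨_, involutive_matrix_mem_unitaryGroup orLabel_involutive⟩
  let A : QuantumAlgorithm n 1 0 :=
    ⟨(⟨0, hn⟩, false, false, false, fun _ => false), fun t => if t = 0 then U else V⟩
  have hstate : ∀ x z, A.state x 1 z = initialState n (queryLabel x (orLabel z)) := by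
    intro x z
    have h : A.state x 1 = V.1 *ᵥ (queryMatrix x *ᵥ (initialState n)) := by
      simp [QuantumAlgorithm.state, A, ← hU]
    rw [h]
    exact (involutive_matrix_mulVec orLabel_involutive _ _).trans (queryMatrix_mulVec _ _ _)
  -- Each index carries mass `1 / n`: a one bit sends all of it to output `1`, a zero bit only the
  -- flagged third.
  have hprob : ∀ x v, A.prob x (fun z => z.a == v) =
      ∑ i, if x i = true then (if v = true then 1 / (n : ℝ) else 0)
        else (if v = true then 1 / (3 * n) else 2 / (3 * n) : ℝ) := by
    intro x v
    simp only [QuantumAlgorithm.prob, hstate, norm_initialState_sq]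
    rw [Fintype.sum_prod_type]
    refine Finset.sum_congr rfl fun i _ => ?_
    cases hx : x i <;> cases v <;>
      simp [Fintype.sum_prod_type, queryLabel, orLabel, Label.a, hx]
    field_simp
    norm_num
  refine ⟨A, fun x => ?_⟩
  rw [hprob, Finset.sum_ite, Finset.sum_const, Finset.sum_const]
  have hsum := weight_add_card_filter_false x.1
  simp only [Bool.not_eq_true]
  rw [← weight]
  set k := (Finset.univ.filter fun i => x.1 i = false).card
  have hs : (weight x.1 : ℝ) + k = n := by exact_mod_cast hsum
  cases hv : (majorityOrNone n).val x
  · rw [majorityOrNone_val_eq_false.1 hv] at hs ⊢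
    have : (k : ℝ) = n := by simpa using hs
    simp [this]
    field_simp
    norm_num
  · have hw : (n : ℝ) ≤ 2 * weight x.1 := by
      exact_mod_cast majorityOrNone_le_two_mul_weight hv
    simp
    field_simp
    linarith

end BoolQuery

theorem mainTheorem7 :
    (∃ C : ℕ, ∀ n : ℕ, 1 ≤ n →
      BoolQuery.oneSidedQueryComplexity (1 / 3) (BoolQuery.majorityOrNone n) ≤ C ∧
      BoolQuery.quantumQueryComplexity (1 / 3) (BoolQuery.majorityOrNone n) ≤ C ∧
      BoolQuery.approxDegree (1 / 3) (BoolQuery.majorityOrNone n) ≤ C) ∧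
    (∃ K : ℕ, ∀ n : ℕ, 1 ≤ n →
      (n : ℕ∞) ≤ K * BoolQuery.rationalDegree (BoolQuery.majorityOrNone n) ∧
      (n : ℕ∞) ≤ K * BoolQuery.postQuantumQueryComplexity 0 (BoolQuery.majorityOrNone n)) := by
  -- `C = 3` is the largest of the three bounds `2`, `1`, `3`; `K = 2` because both lower bounds are
  -- `(n + 1) / 2`, rounded down.
  refine ⟨⟨3, fun n hn => ⟨?_, ?_, BoolQuery.approxDegree_majorityOrNone_le hn⟩⟩,
    ⟨2, fun n hn => ?_⟩⟩
  · exact (iInf₂_le 2 (BoolQuery.oneSidedComputable_majorityOrNone hn)).trans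
      (Nat.cast_le.2 (by norm_num))
  · exact (iInf₂_le 1 ⟨0, BoolQuery.exists_computes_majorityOrNone hn⟩).trans
      (Nat.cast_le.2 (by norm_num))
  · have hhalf : ∀ {a : ℕ∞}, (((n + 1) / 2 : ℕ) : ℕ∞) ≤ a → (n : ℕ∞) ≤ (2 : ℕ) * a := by
      intro a ha
      refine le_trans ?_ (mul_le_mul_right ha _)
      exact_mod_cast (by omega : n ≤ 2 * ((n + 1) / 2))
    exact ⟨hhalf (BoolQuery.half_le_rationalDegree hn),
      hhalf (BoolQuery.half_le_postQuantumQueryComplexity hn)⟩
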